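/- **Conventions.** Strings are finite binary strings. $U$ is a universal prefix machine (with side input), $K_U(x\mid y)$ is the length of a shortest $U$-program for $x$ given $y$, $K_U(x)=K_U(x\mid\varepsilon)$ with $\varepsilon$ the empty string, and $$I_{\mathrm{alg}}(x:y):=K_U(y)-K_U(y\mid x)$$ is the algorithmic information that $x$ carries about $y$. An adaptation process is a computable device acting on a control state, the content of the execution substrate, the content of an input register, and the bit cells of the adaptation substrate $\mathcal H_{\mathrm{adapt}}$. Each of its steps is either logically reversible, i.e. a deterministic move to a configuration that has no other predecessor, or a logical erasure, i.e. an irreversible overwriting of one cell of $\mathcal H_{\mathrm{adapt}}$ by a bit (not necessarily determined by the past) which loses only the old content of that cell. The process starts in a fixed control state with initial execution-substrate state $S_0$, adaptation input $\mathcal D$ and blank adaptation substrate; it halts with execution-substrate state $S$ after $H_{\mathrm{erase}}$ logical erasures. For a task class $\mathcal C$ with descriptor $\sigma(\mathcal C)$ (any string), put $\mu:=I_{\mathrm{alg}}(S:\sigma(\mathcal C))$. Let $c=k_BT\ln 2$ with temperature $T>0$, let $F(\mathcal H_{\mathrm{adapt}})\ge 1$ be the overhead factor of the adaptation substrate, and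 let the adaptation energy obey the Landauer floor $E_{\mathrm{adapt}}\ge F(\mathcal H_{\mathrm{adapt}})\,H_{\mathrm{erase}}\,c$. **Theorem (Thermodynamic cost of structural information).** For every universal prefix machine $U$ and every $b\in\mathbb N$ there is a constant $c_U\in\mathbb N$, depending only on $U$ and $b$, such that the following holds. For every adaptation process with description of complexity at most $b$, every descriptor $\sigma(\mathcal C)$, every initial state $S_0$ with no information about it, in the sense that $K_U(\sigma(\mathcal C))\le K_U(\sigma(\mathcal C)\mid S_0)+b$, every adaptation input $\mathcal D$, and every halting run of the process from $(S_0,\mathcal D)$ to a final execution-substrate state $S$, $$E_{\mathrm{adapt}}\;\ge\;F(\mathcal H_{\mathrm{adapt}})\,c\,\bigl[\mu-I_{\mathrm{alg}}(\mathcal D:\sigma(\mathcal C))-c_U\bigr]_+ ,\qquad [x]_+:=\max(x,0).$$ -/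

import Mathlib

/-! ## Prefix Kolmogorov complexity -/

/-- A (conditional) prefix machine: a partial recursive function of a program `p` and a side
input `y` whose domain is prefix-free in `p` for every fixed `y`. -/
structure PrefixMachine where
  eval : List Bool → List Bool →. List Bool
  partrec : Partrec₂ eval
  prefix_free : ∀ y p q : List Bool,
    (eval p y).Dom → (eval q y).Dom → p <+: q → p = q

namespace PrefixMachine

/-- `U` is universal: it simulates every prefix machine `V` with programs that are longer by at
most an additive constant depending only on `V` (this holds in particular when
`U (w ++ p) y = V p y` for a fixed compiler prefix `w`). -/
def IsUniversal (U : PrefixMachine) : Prop :=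
  ∀ V : PrefixMachine, ∃ d : ℕ, ∀ p y x : List Bool,
    x ∈ V.eval p y → ∃ q : List Bool, q.length ≤ p.length + d ∧ x ∈ U.eval q y

/-- Conditional prefix complexity `K_U(x | y)`: the length of a shortest program for `x` given
`y`. For a universal `U` the set of lengths is never empty. -/
noncomputable def condK (U : PrefixMachine) (x y : List Bool) : ℕ :=
  sInf {n : ℕ | ∃ p : List Bool, p.length = n ∧ x ∈ U.eval p y}

/-- Prefix complexity `K_U(x)`: there is no side input. -/
noncomputable def K (U : PrefixMachine) (x : List Bool) : ℕ :=
  U.condK x []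

/-- Algorithmic mutual information `I_alg(x : y) = K_U(y) - K_U(y | x)`, the information that `x`
carries about `y`. -/
noncomputable def mutualInfo (U : PrefixMachine) (x y : List Bool) : ℝ :=
  (U.K y : ℝ) - (U.condK y x : ℝ)

end PrefixMachine

/-! ## Adaptation processes and logical erasures -/

/-- A configuration `(control, exec, input, work)` of an adaptation device: the control state, the
contents of the execution substrate, of the register holding the adaptation input, and of the
bit cells of the adaptation substrate. -/
abbrev AdaptConfig : Type := ℕ × List Bool × List Bool × List Bool

/-- What the device does in a configuration: `none` is halting, `some (Sum.inl q)` is a logically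
reversible move to `q`, and `some (Sum.inr (i, l))` is a logical erasure of cell `i` of the
adaptation substrate, after which the control state is `l`. -/
abbrev AdaptInstr : Type := Option (AdaptConfig ⊕ (ℕ × ℕ))

/-- `AdaptStep instr q n r`: the device can go from `q` to `r` in one step that performs `n` logical
erasures. An erasure destroys the old content of one cell of the adaptation substrate and leaves
a bit `v` there, which the earlier configuration need not determine: `v = false` is a reset, and
in general this is an irreversible write. All other steps are determined by the configuration, so
irreversible writes are the only way in which information that is not
computable from the initial configuration can enter. -/
inductive AdaptStep (instr : AdaptConfig → AdaptInstr) : AdaptConfig → ℕ → AdaptConfig → Prop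
  | reversible (q r : AdaptConfig) (h : instr q = some (Sum.inl r)) : AdaptStep instr q 0 r
  | erase (k l i : ℕ) (S D W : List Bool) (v : Bool)
      (h : instr (k, S, D, W) = some (Sum.inr (i, l))) (hi : i < W.length) :
      AdaptStep instr (k, S, D, W) 1 (l, S, D, W.set i v)

/-- `AdaptRun instr q n r`: the device can go from `q` to `r` in finitely many steps that perform
`n` logical erasures altogether. -/
inductive AdaptRun (instr : AdaptConfig → AdaptInstr) : AdaptConfig → ℕ → AdaptConfig → Prop
  | refl (q : AdaptConfig) : AdaptRun instr q 0 q
  | step (q r s : AdaptConfig) (m n : ℕ) (h₁ : AdaptRun instr q m r)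
      (h₂ : AdaptStep instr r n s) : AdaptRun instr q (m + n) s

/-- An adaptation process: an effectively given device each of whose steps is either logically
reversible or erases exactly one bit. -/
structure AdaptationProcess where
  /-- The program of the device. -/
  code : Nat.Partrec.Code
  /-- The instruction carried out in each configuration. -/
  instr : AdaptConfig → AdaptInstr
  computes : ∀ q : AdaptConfig,
    code.eval (Encodable.encode q) = Part.some (Encodable.encode (instr q))
  /-- A configuration reached by a reversible move has no other predecessor. -/
  reversible_inj : ∀ (q r q' : AdaptConfig) (n : ℕ),
    instr q = some (Sum.inl r) → AdaptStep instr q' n r → q' = q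
  /-- Two predecessors of a configuration reached by erasures have the same control state and the
  same erased cell, hence differ at most in the bit that the erasure destroyed. -/
  erase_one_bit : ∀ (q q' r : AdaptConfig) (i j l l' : ℕ),
    instr q = some (Sum.inr (i, l)) → instr q' = some (Sum.inr (j, l')) →
    AdaptStep instr q 1 r → AdaptStep instr q' 1 r → q.1 = q'.1 ∧ i = j

namespace AdaptationProcess

/-- The description of the process as a binary string. -/
def description (P : AdaptationProcess) : List Bool :=
  Nat.bits (Encodable.encode P.code)

/-- `P.Adapts S₀ D S H`: started in control state `0` with execution substrate `S₀`, adaptation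
input `D` and blank adaptation substrate, the process can halt with execution substrate `S` after
performing exactly `H` logical erasures on the adaptation substrate. -/
def Adapts (P : AdaptationProcess) (S₀ D S : List Bool) (H : ℕ) : Prop :=
  ∃ (k : ℕ) (D' W : List Bool),
    AdaptRun P.instr (0, S₀, D, []) H (k, S, D', W) ∧ P.instr (k, S, D', W) = none

end AdaptationProcess

/-! ## Energy -/

/-- Boltzmann's constant in joules per kelvin. -/
noncomputable def boltzmannConstant : ℝ := 1.380649e-23

/-- The Landauer cost `c = k_B T ln 2` of one erased bit at temperature `T`. -/
noncomputable def landauerCost (T : ℝ) : ℝ := boltzmannConstant * T * Real.log 2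

/-- The energetic data of a substrate: its overhead factor `F ≥ 1` relative to the Landauer
benchmark. -/
structure Substrate where
  overhead : ℝ
  one_le_overhead : 1 ≤ overhead

/-- The substrate-floor hypothesis (Landauer floor): `N` irreversible bit-operations on the
substrate at temperature `T` cost an energy `E ≥ F · N · c`. -/
def Substrate.EnergyFloor (X : Substrate) (T : ℝ) (N : ℕ) (E : ℝ) : Prop :=
  X.overhead * (N : ℝ) * landauerCost T ≤ E

/-! Since the energy is at least `F * c * H`, it suffices to show K(σ | D) ≤ K(σ | S) + H + O(1).
Describe σ from D by the H bits that the erasures write, followed by a shortest program for σ given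
S: rerun the device on D, reading one bit at each erasure, and hand the unread rest to `U`
(`adaptMachine`). The run itself determines where its bits end, so no extra bits are spent on H.

The rerun needs S₀, which is arbitrary and cannot be recovered from D. The way out is
`exists_bound_of_independent`: for fixed b, K(σ) ≤ K(σ | S₀) + b forces σ or S₀ into a fixed finite
set. If S₀ lies there, it is hard-wired into the machine; processes of complexity at most b have
finitely many descriptions, so one constant serves all. If σ lies there, K(σ | D) is bounded
outright.

That lemma holds because any y with a large number N helps to compress every x with a large number.
After N stages most of the measure 2^{-|p|} of halting programs is known, so N yields a decidable
tail of outputs of total measure at most 2^{-h}. Stretching the Kraft intervals of the tail programs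
by 2^h gives codes shorter by h - 1 bits. With h = 2g, announcing g in unary costs g + 1 bits, and
the net gain g - 2 can be made as large as desired. -/

/-! ## Binary values of strings and the Kraft inequality -/

/-- The number with binary expansion `q`, most significant bit first. -/
def binVal (q : List Bool) : ℕ :=
  q.foldl (fun a c => 2 * a + c.toNat) 0

theorem binVal_concat (q : List Bool) (c : Bool) :
    binVal (q ++ [c]) = 2 * binVal q + c.toNat := by
  simp [binVal]

theorem binVal_append_bounds (q r : List Bool) :
    binVal q * 2 ^ r.length ≤ binVal (q ++ r) ∧
      binVal (q ++ r) + 1 ≤ (binVal q + 1) * 2 ^ r.length := by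
  induction r using List.reverseRecOn with
  | nil => simp
  | append_singleton r c ih =>
    rw [← List.append_assoc, binVal_concat]
    have hc : c.toNat ≤ 1 := Bool.toNat_le c
    simp only [List.length_append, List.length_cons, List.length_nil, zero_add, pow_succ]
    constructor <;> nlinarith [ih.1, ih.2]

theorem exists_binVal_eq (l t : ℕ) (ht : t < 2 ^ l) :
    ∃ q : List Bool, q.length = l ∧ binVal q = t := by
  induction l generalizing t with
  | zero => exact ⟨[], rfl, by simp at ht; simp [binVal, ht]⟩
  | succ l ih =>
    obtain ⟨q, hq, hv⟩ := ih (t / 2) (by rw [pow_succ] at ht; omega)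
    refine ⟨q ++ [decide (t % 2 = 1)], by simp [hq], ?_⟩
    rw [binVal_concat, hv]
    rcases Nat.mod_two_eq_zero_or_one t with h | h <;> simp [h] <;> omega

/-- Kraft's inequality by counting: the sets of length-`M` extensions of the `p i` are disjoint. -/
theorem sum_two_pow_le_of_prefix_free {ι : Type*} (s : Finset ι) (p : ι → List Bool) (M : ℕ)
    (hM : ∀ i ∈ s, (p i).length ≤ M)
    (hp : ∀ i ∈ s, ∀ j ∈ s, p i <+: p j → i = j) :
    ∑ i ∈ s, 2 ^ (M - (p i).length) ≤ 2 ^ M := by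
  classical
  let B : ι → Finset (List.Vector Bool M) := fun i =>
    Finset.univ.filter fun v => p i <+: v.toList
  have hB : ∀ i ∈ s, 2 ^ (M - (p i).length) ≤ (B i).card := by
    intro i hi
    have hl : (p i).length + (M - (p i).length) = M := Nat.add_sub_cancel' (hM i hi)
    let f : List.Vector Bool (M - (p i).length) → List.Vector Bool M := fun r =>
      ⟨p i ++ r.toList, by simp [hl]⟩
    have hf : Function.Injective f := by
      intro r r' h
      have := congrArg List.Vector.toList h
      exact List.Vector.toList_injective (List.append_cancel_left this)
    have hc : (Finset.univ.image f).card = 2 ^ (M - (p i).length) := by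
      rw [Finset.card_image_of_injective _ hf]
      simp
    rw [← hc]
    refine Finset.card_le_card fun v hv => ?_
    obtain ⟨r, -, rfl⟩ := Finset.mem_image.1 hv
    exact Finset.mem_filter.2 ⟨Finset.mem_univ _, r.toList, rfl⟩
  have hdisj : (s : Set ι).PairwiseDisjoint B := by
    intro i hi j hj hij
    refine Finset.disjoint_left.2 fun v hv hv' => hij ?_
    rcases List.prefix_or_prefix_of_prefix (Finset.mem_filter.1 hv).2
      (Finset.mem_filter.1 hv').2 with h | h
    · exact hp i hi j hj h
    · exact (hp j hj i hi h).symm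
  calc ∑ i ∈ s, 2 ^ (M - (p i).length) ≤ ∑ i ∈ s, (B i).card := Finset.sum_le_sum hB
    _ = (s.biUnion B).card := (Finset.card_biUnion hdisj).symm
    _ ≤ (Finset.univ : Finset (List.Vector Bool M)).card := Finset.card_le_univ _
    _ = 2 ^ M := by simp

/-! ## Primitive recursive enumeration of programs -/

/-- `IsProgramEnum U e`: `e` lists every halting program of `U` (without side input) together with
its output exactly once, and a program is not longer than its index. -/
structure IsProgramEnum (U : PrefixMachine) (e : ℕ → Option (List Bool × List Bool)) : Prop where
  primrec : Primrec e
  sound : ∀ i p x, e i = some (p, x) → x ∈ U.eval p []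
  complete : ∀ p x, x ∈ U.eval p [] → ∃ i, e i = some (p, x)
  unique : ∀ i j p x y, e i = some (p, x) → e j = some (p, y) → i = j
  length_le : ∀ i p x, e i = some (p, x) → p.length ≤ i

/-- An index encodes a pair `(k, p)`, and it lists `p` only if `evaln` fails on `p` at stage `k` and
succeeds at `k + 1`. Monotonicity of `evaln` makes this `k` unique. -/
theorem PrefixMachine.exists_isProgramEnum (U : PrefixMachine) :
    ∃ e, IsProgramEnum U e := by
  have hU : Partrec fun p : List Bool => U.eval p [] :=
    Partrec₂.comp U.partrec Computable.id (Computable.const [])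
  obtain ⟨c, hc⟩ := Nat.Partrec.Code.exists_code.1 hU
  have hev : ∀ p x, x ∈ U.eval p [] ↔
      Encodable.encode x ∈ c.eval (Encodable.encode p) := by
    intro p x
    rw [hc]
    simp
  let st : ℕ → ℕ → Option ℕ := fun k n => Nat.Partrec.Code.evaln k c n
  have hst : Primrec₂ st :=
    (Nat.Partrec.Code.primrec_evaln.comp
      ((Primrec.fst.pair (Primrec.const c)).pair Primrec.snd)).to₂
  let out : ℕ × List Bool → Option (List Bool × List Bool) := fun a =>
    if st a.1 (Encodable.encode a.2) = none then
      (st (a.1 + 1) (Encodable.encode a.2)).bind fun n =>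
        (Encodable.decode n : Option (List Bool)).map fun x => (a.2, x)
    else none
  let e : ℕ → Option (List Bool × List Bool) := fun i =>
    (Encodable.decode₂ (ℕ × List Bool) i).bind out
  have hout : ∀ k p x, (out (k, p) = some (p, x) ↔
      (st k (Encodable.encode p) = none ∧
        st (k + 1) (Encodable.encode p) = some (Encodable.encode x))) := by
    rintro k p x
    have hdec : ∀ n, n ∈ c.eval (Encodable.encode p) →
        ∃ y : List Bool, n = Encodable.encode y := by
      intro n hn
      rw [hc] at hn
      simp at hn
      obtain ⟨y, -, hy⟩ := hn
      exact ⟨y, hy.symm⟩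
    simp only [out]
    by_cases h : st k (Encodable.encode p) = none
    · simp only [h, if_true, true_and]
      rcases hs : st (k + 1) (Encodable.encode p) with _ | n
      · simp
      · obtain ⟨y, rfl⟩ := hdec n (Nat.Partrec.Code.evaln_sound hs)
        simp
    · simp [h]
  have he : ∀ k p i x, i = Encodable.encode (k, p) → (e i = some (p, x) ↔
      (st k (Encodable.encode p) = none ∧
        st (k + 1) (Encodable.encode p) = some (Encodable.encode x))) := by
    rintro k p i x rfl
    simp only [e, Encodable.decode₂_encode, Option.bind_some]
    exact hout k p x
  have he' : ∀ i p x, e i = some (p, x) → ∃ k : ℕ, i = Encodable.encode (k, p) := by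
    intro i p x h
    obtain ⟨⟨k, q⟩, ha, h⟩ := Option.bind_eq_some_iff.1 h
    have hq : q = p := by
      simp only [out] at h
      split_ifs at h
      simp only [Option.bind_eq_some_iff, Option.map_eq_some_iff, Prod.mk.injEq] at h
      obtain ⟨_, _, _, _, h, _⟩ := h
      exact h
    subst hq
    exact ⟨k, (Encodable.mem_decode₂.1 ha).symm⟩
  refine ⟨e, ?_, ?_, ?_, ?_, ?_⟩
  · have hp' : Primrec fun a : ℕ × List Bool => Encodable.encode a.2 :=
      Primrec.encode.comp Primrec.snd
    have ho : Primrec out := by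
      refine Primrec.ite (Primrec.eq.comp (hst.comp Primrec.fst hp') (Primrec.const none)) ?_
        (Primrec.const none)
      refine Primrec.option_bind (hst.comp (Primrec.succ.comp Primrec.fst) hp') ?_
      exact Primrec.option_map (Primrec.decode.comp Primrec.snd)
        ((Primrec.snd.comp (Primrec.fst.comp Primrec.fst)).pair Primrec.snd)
    exact Primrec.option_bind Primrec.decode₂ (ho.comp Primrec.snd)
  · intro i p x h
    obtain ⟨k, hk⟩ := he' i p x h
    exact (hev p x).2 (Nat.Partrec.Code.evaln_sound ((he k p i x hk).1 h).2)
  · intro p x h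
    obtain ⟨k, hk⟩ := Nat.Partrec.Code.evaln_complete.1 ((hev p x).1 h)
    have hex : ∃ k, (st k (Encodable.encode p)).isSome := 
      ⟨k, Option.isSome_iff_exists.2 ⟨_, hk⟩⟩
    classical
    -- `evaln` at stage 0 never succeeds, so the first successful stage is a successor.
    obtain ⟨m, hm⟩ : ∃ m, Nat.find hex = m + 1 := by
      refine Nat.exists_eq_succ_of_ne_zero fun h0 => ?_
      have := Nat.find_spec hex
      rw [h0] at this
      simp [st, Nat.Partrec.Code.evaln] at this
    refine ⟨_, (he m p _ x rfl).2 ⟨?_, ?_⟩⟩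
    · simpa using Nat.find_min hex (show m < Nat.find hex by omega)
    · obtain ⟨n, hn⟩ := Option.isSome_iff_exists.1 (Nat.find_spec hex)
      rw [hm] at hn
      rw [hn]
      exact congrArg some (Part.mem_unique (Nat.Partrec.Code.evaln_sound hn)
        (Nat.Partrec.Code.evaln_sound hk))
  · intro i j p x y hi hj
    obtain ⟨k, hk⟩ := he' i p x hi
    obtain ⟨l, hl⟩ := he' j p y hj
    have h1 := (he k p i x hk).1 hi
    have h2 := (he l p j y hl).1 hj
    have key : ∀ a b u, st a (Encodable.encode p) = none →
        st (b + 1) (Encodable.encode p) = some u → a ≤ b := by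
      intro a b u ha hb
      by_contra! hlt
      have := Nat.Partrec.Code.evaln_mono (show b + 1 ≤ a by omega) hb
      simp only [st] at ha
      simp [ha] at this
    have : k = l := le_antisymm (key _ _ _ h1.1 h2.2) (key _ _ _ h2.1 h1.2)
    rw [hk, hl, this]
  · intro i p x h
    obtain ⟨k, hk⟩ := he' i p x h
    rw [hk]
    exact (Encodable.length_le_encode p).trans (Nat.right_le_pair _ _)

/-! ## Two strings with only constant mutual information are not both long -/

theorem Primrec.sum_range {α : Type*} [Primcodable α] {f : α → ℕ → ℕ} {g : α → ℕ}
    (hf : Primrec₂ f) (hg : Primrec g) :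
    Primrec fun a => ∑ j ∈ Finset.range (g a), f a j := by
  refine (Primrec.nat_rec' (h := fun a p => p.2 + f a p.1) hg (Primrec.const 0)
    (Primrec.nat_add.comp (Primrec.snd.comp Primrec.snd)
      (hf.comp Primrec.fst (Primrec.fst.comp Primrec.snd))).to₂).of_eq fun a => ?_
  induction g a with
  | zero => rfl
  | succ n ih => rw [Finset.sum_range_succ, ← ih]

theorem Primrec.two_pow : Primrec fun n : ℕ => 2 ^ n := by
  refine (Primrec.nat_rec' (f := id) (g := fun _ => 1) (h := fun (_ : ℕ) (p : ℕ × ℕ) => 2 * p.2)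
    Primrec.id (Primrec.const 1)
    (Primrec.nat_mul.comp (Primrec.const 2) (Primrec.snd.comp Primrec.snd)).to₂).of_eq fun a => ?_
  induction a with
  | zero => rfl
  | succ n ih => rw [pow_succ', ← ih]; rfl

theorem primrec_binVal : Primrec binVal := by
  refine Primrec.list_foldl (f := id) (g := fun _ => 0)
    (h := fun (_ : List Bool) (p : ℕ × Bool) => 2 * p.1 + p.2.toNat) Primrec.id (Primrec.const 0) ?_
  exact Primrec.nat_add.comp
    (Primrec.nat_mul.comp (Primrec.const 2) (Primrec.fst.comp Primrec.snd))
    ((Primrec.dom_finite Bool.toNat).comp (Primrec.snd.comp Primrec.snd))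

/-! ### Shortened codes for programs with output in the tail -/

section Recoding

variable (e : ℕ → Option (List Bool × List Bool))

/-- The measure `2^{-|p|}` of the program at index `j`. -/
noncomputable def programWeight (j : ℕ) : ℝ :=
  (e j).elim 0 fun a => (2 ^ a.1.length)⁻¹

/-- `programWeight` in units of `2^{-M}`. -/
def scaledWeight (M j : ℕ) : ℕ :=
  (e j).elim 0 fun a => 2 ^ (M - a.1.length)

/-- The number of the output of the program at index `j`. -/
def outputNumber (j : ℕ) : ℕ :=
  (e j).elim 0 fun a => Encodable.encode a.2

/-- At stage `N` the known programs with output number at least `n` have measure at most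
`2^{-h-1}`. -/
def InTail (N h n : ℕ) : Prop :=
  ∑ j ∈ Finset.range N, (if n ≤ outputNumber e j then programWeight e j else 0) ≤
    ((2 : ℝ) ^ (h + 1))⁻¹

open Classical in
/-- The total measure of the programs of index below `i` whose output is in the tail. -/
noncomputable def tailMeasure (N h i : ℕ) : ℝ :=
  ∑ j ∈ Finset.range i, if InTail e N h (outputNumber e j) then programWeight e j else 0

/-- `q` is a code of the program at index `i`, shorter than that program by `h - 1` bits: the dyadic
interval of `q` lies in the interval allotted to the program, enlarged by `2^h`. -/
def IsTailCode (N h i : ℕ) (q : List Bool) : Prop :=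
  InTail e N h (outputNumber e i) ∧
    (∃ a, e i = some a ∧ q.length + h = a.1.length + 1) ∧
    2 ^ h * tailMeasure e N h i ≤ binVal q / 2 ^ q.length ∧
    (binVal q + 1 : ℝ) / 2 ^ q.length ≤ 2 ^ h * (tailMeasure e N h i + programWeight e i)

variable {e}

theorem programWeight_nonneg (j : ℕ) : 0 ≤ programWeight e j := by
  unfold programWeight
  rcases e j with _ | a <;> simp

theorem programWeight_of_eq {i : ℕ} {a : List Bool × List Bool} (h : e i = some a) :
    programWeight e i = (2 ^ a.1.length)⁻¹ := by
  simp [programWeight, h]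

theorem outputNumber_of_eq {i : ℕ} {a : List Bool × List Bool} (h : e i = some a) :
    outputNumber e i = Encodable.encode a.2 := by
  simp [outputNumber, h]

theorem tailMeasure_succ_le {N h i k : ℕ} (hi : InTail e N h (outputNumber e i)) (hik : i < k) :
    tailMeasure e N h i + programWeight e i ≤ tailMeasure e N h k := by
  classical
  have : tailMeasure e N h i + programWeight e i = tailMeasure e N h (i + 1) := by
    simp [tailMeasure, Finset.sum_range_succ, hi]
  rw [this]
  refine Finset.sum_le_sum_of_subset_of_nonneg (Finset.range_mono hik) fun j _ _ => ?_
  split_ifs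
  · exact programWeight_nonneg j
  · exact le_rfl

/-- Intervals allotted to different programs do not overlap, while a prefix relation nests the
dyadic intervals. No bound on the tail measure enters, so the recoding machine is prefix-free for
every side input. -/
theorem IsTailCode.eq_of_prefix {N h i k : ℕ} {q r : List Bool} (hq : IsTailCode e N h i q)
    (hr : IsTailCode e N h k r) (hqr : q <+: r) : i = k ∧ q = r := by
  obtain ⟨hi, ⟨a, ha, hla⟩, hq1, hq2⟩ := hq
  obtain ⟨hk, ⟨b, hb, hlb⟩, hr1, hr2⟩ := hr
  obtain ⟨s, rfl⟩ := hqr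
  have hb1 : (binVal q : ℝ) / 2 ^ q.length ≤ binVal (q ++ s) / 2 ^ (q ++ s).length := by
    rw [div_le_div_iff₀ (by positivity) (by positivity), List.length_append, pow_add]
    have : (binVal q * 2 ^ s.length : ℝ) ≤ binVal (q ++ s) := by
      exact_mod_cast (binVal_append_bounds q s).1
    nlinarith [show (0 : ℝ) < 2 ^ q.length by positivity]
  have hb2 : (binVal (q ++ s) + 1 : ℝ) / 2 ^ (q ++ s).length ≤ (binVal q + 1) / 2 ^ q.length := by
    rw [div_le_div_iff₀ (by positivity) (by positivity), List.length_append, pow_add]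
    have : (binVal (q ++ s) + 1 : ℝ) ≤ (binVal q + 1) * 2 ^ s.length := by
      exact_mod_cast (binVal_append_bounds q s).2
    nlinarith [show (0 : ℝ) < 2 ^ q.length by positivity]
  have hb3 : (binVal (q ++ s) : ℝ) / 2 ^ (q ++ s).length <
      (binVal (q ++ s) + 1 : ℝ) / 2 ^ (q ++ s).length := by
    gcongr
    linarith
  have h2 : (0 : ℝ) ≤ 2 ^ h := by positivity
  rcases lt_trichotomy i k with hlt | rfl | hlt
  · have := mul_le_mul_of_nonneg_left (tailMeasure_succ_le hi hlt) h2
    linarith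
  · refine ⟨rfl, ?_⟩
    obtain rfl : a = b := Option.some.inj (ha.symm.trans hb)
    have : s.length = 0 := by
      rw [List.length_append] at hlb
      omega
    simp [List.length_eq_zero_iff.1 this]
  · have := mul_le_mul_of_nonneg_left (tailMeasure_succ_le hk hlt) h2
    linarith

/-- An interval of length 2^{-m} in [0, 1] contains an aligned dyadic interval of half that length.
This halving is the one bit lost from the gain `h`. -/
theorem exists_isTailCode {N h i : ℕ} {a : List Bool × List Bool} (ha : e i = some a)
    (hi : InTail e N h (outputNumber e i))
    (hle : tailMeasure e N h (i + 1) ≤ (2 ^ h)⁻¹) : ∃ q, IsTailCode e N h i q := by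
  have hw := programWeight_of_eq ha
  have hsum := (tailMeasure_succ_le hi (Nat.lt_succ_self i)).trans hle
  have hpos : 0 ≤ tailMeasure e N h i := by
    classical
    refine Finset.sum_nonneg fun j _ => ?_
    split_ifs
    · exact programWeight_nonneg j
    · exact le_rfl
  -- A single tail program weighs no more than the whole tail.
  have hlen : h ≤ a.1.length := by
    have : ((2 : ℝ) ^ a.1.length)⁻¹ ≤ (2 ^ h)⁻¹ := by linarith
    rw [inv_le_inv₀ (by positivity) (by positivity)] at this
    exact (pow_le_pow_iff_right₀ (by norm_num)).1 this
  obtain ⟨m, hm⟩ := Nat.exists_eq_add_of_le hlen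
  set A := 2 ^ h * tailMeasure e N h i with hA
  have hA0 : 0 ≤ A := by positivity
  have hW : 2 ^ h * programWeight e i = 2 / 2 ^ (m + 1) := by
    rw [hw, hm, pow_add, pow_succ]
    field_simp
  have hA1 : A + 2 / 2 ^ (m + 1) ≤ 1 := by
    have := mul_le_mul_of_nonneg_left hsum (show (0 : ℝ) ≤ 2 ^ h by positivity)
    rw [mul_inv_cancel₀ (by positivity), mul_add, hW] at this
    exact this
  have h2 : (0 : ℝ) < 2 ^ (m + 1) := by positivity
  have hc1 := Nat.le_ceil (A * 2 ^ (m + 1))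
  have hc2 := Nat.ceil_lt_add_one (show 0 ≤ A * 2 ^ (m + 1) by positivity)
  have hA2 : A * 2 ^ (m + 1) + 2 ≤ 2 ^ (m + 1) := by
    have := mul_le_mul_of_nonneg_right hA1 h2.le
    rw [add_mul, div_mul_cancel₀ _ h2.ne', one_mul] at this
    exact this
  -- The enlarged interval spans two grid cells of width 2^{-(m+1)}; rounding its left end up leaves
  -- room for one full cell.
  obtain ⟨q, hq, hv⟩ := exists_binVal_eq (m + 1) ⌈A * 2 ^ (m + 1)⌉₊ (by
    have : (⌈A * 2 ^ (m + 1)⌉₊ : ℝ) < ((2 ^ (m + 1) : ℕ) : ℝ) := by push_cast; linarith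
    exact_mod_cast this)
  refine ⟨q, hi, ⟨a, ha, by omega⟩, ?_, ?_⟩
  · rw [hq, hv, le_div_iff₀ h2]
    exact hc1
  · rw [hq, hv, div_le_iff₀ h2, mul_add, ← hA, hW, add_mul, div_mul_cancel₀ _ h2.ne']
    linarith

theorem sum_programWeight_le_one {U : PrefixMachine} (he : IsProgramEnum U e) (n : ℕ) :
    ∑ j ∈ Finset.range n, programWeight e j ≤ 1 := by
  classical
  let s := (Finset.range n).filter fun j => (e j).isSome
  let p : ℕ → List Bool := fun j => ((e j).getD ([], [])).1
  have hs : ∀ j ∈ s, ∃ x, e j = some (p j, x) := by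
    intro j hj
    obtain ⟨a, ha⟩ := Option.isSome_iff_exists.1 (Finset.mem_filter.1 hj).2
    exact ⟨a.2, by simp [p, ha]⟩
  have hlen : ∀ j ∈ s, (p j).length ≤ n := fun j hj => by
    obtain ⟨x, hx⟩ := hs j hj
    exact (he.length_le j _ x hx).trans (Finset.mem_range.1 (Finset.mem_filter.1 hj).1).le
  have key := sum_two_pow_le_of_prefix_free s p n hlen fun i hi j hj hij => by
      obtain ⟨x, hx⟩ := hs i hi
      obtain ⟨y, hy⟩ := hs j hj
      have := U.prefix_free [] _ _ (Part.dom_iff_mem.2 ⟨x, he.sound i _ x hx⟩)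
        (Part.dom_iff_mem.2 ⟨y, he.sound j _ y hy⟩) hij
      exact he.unique i j (p i) x y hx (this ▸ hy)
  have hsum : ∑ j ∈ Finset.range n, programWeight e j = ∑ j ∈ s, programWeight e j := by
    refine (Finset.sum_filter_of_ne fun j _ hj => ?_).symm
    rcases hej : e j with _ | a
    · exact absurd (by simp [programWeight, hej]) hj
    · rfl
  have hw : ∀ j ∈ s, programWeight e j = ((2 ^ (n - (p j).length) : ℕ) : ℝ) / 2 ^ n := by
    intro j hj
    obtain ⟨x, hx⟩ := hs j hj
    obtain ⟨m, hm⟩ := Nat.exists_eq_add_of_le (hlen j hj)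
    rw [programWeight_of_eq hx]
    have : n - (p j).length = m := by omega
    rw [this, hm]
    push_cast
    rw [pow_add]
    field_simp
  rw [hsum, Finset.sum_congr rfl hw, ← Finset.sum_div, div_le_one (by positivity)]
  exact_mod_cast key

theorem exists_tail_bounds {U : PrefixMachine} (he : IsProgramEnum U e) (h : ℕ) :
    ∃ M, ∀ N, M ≤ N → (∀ n, M ≤ n → InTail e N h n) ∧ ∀ i, tailMeasure e N h i ≤ (2 ^ h)⁻¹ := by
  classical
  have hsm : Summable (programWeight e) :=
    summable_of_sum_range_le programWeight_nonneg (sum_programWeight_le_one he)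
  set ε : ℝ := (2 ^ (h + 1))⁻¹ with hε
  have hε0 : 0 < ε := by positivity
  obtain ⟨J, hJ⟩ : ∃ J, ∀ s : Finset ℕ, (∀ j ∈ s, J ≤ j) → ∑ j ∈ s, programWeight e j ≤ ε := by
    obtain ⟨t, ht⟩ := summable_iff_vanishing_norm.1 hsm ε hε0
    refine ⟨t.sup id + 1, fun s hs => ?_⟩
    refine (le_abs_self _).trans (ht s (Finset.disjoint_left.2 fun j hj hjt => ?_)).le
    have h1 := hs j hj
    have h2 : j ≤ t.sup id := Finset.le_sup (f := id) hjt
    omega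
  -- Beyond this threshold, an output number exceeds those of all programs of index below `J`, so
  -- only the light remainder can contribute.
  refine ⟨max J ((Finset.range J).sup (outputNumber e) + 1), fun N hN => ⟨fun n hn => ?_, ?_⟩⟩
  · unfold InTail
    rw [← Finset.sum_filter]
    refine hJ _ fun j hj => ?_
    by_contra! hlt
    have h1 : outputNumber e j ≤ (Finset.range J).sup (outputNumber e) :=
      Finset.le_sup (Finset.mem_range.2 hlt)
    have h2 := (Finset.mem_filter.1 hj).2
    have := (le_max_right _ _).trans hn
    omega
  · intro i
    unfold tailMeasure
    -- Tail programs not yet known at stage `N` have index at least `J` and weigh at most `ε`; the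
    -- known ones weigh at most `ε` by the tail condition at their least output number.
    rw [← Finset.sum_filter, ← Finset.sum_filter_add_sum_filter_not _ (fun j => j < N)]
    have h1 : ∑ j ∈ ((Finset.range i).filter fun j =>
        InTail e N h (outputNumber e j)).filter (fun j => ¬ j < N), programWeight e j ≤ ε :=
      hJ _ fun j hj => by
        have := (Finset.mem_filter.1 hj).2
        have := (le_max_left _ _).trans hN
        omega
    have h2 : ∑ j ∈ ((Finset.range i).filter fun j =>
        InTail e N h (outputNumber e j)).filter (fun j => j < N), programWeight e j ≤ ε := by
      set s := ((Finset.range i).filter fun j =>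
        InTail e N h (outputNumber e j)).filter (fun j => j < N) with hs
      rcases s.eq_empty_or_nonempty with h0 | h0
      · simp [h0, hε0.le]
      · obtain ⟨k, hk, hmin⟩ := s.exists_min_image (outputNumber e) h0
        have hkt : InTail e N h (outputNumber e k) :=
          (Finset.mem_filter.1 (Finset.mem_filter.1 hk).1).2
        refine le_trans ?_ hkt
        rw [← Finset.sum_filter]
        refine Finset.sum_le_sum_of_subset_of_nonneg (fun j hj => ?_)
          fun j _ _ => programWeight_nonneg j
        exact Finset.mem_filter.2 ⟨Finset.mem_range.2 (Finset.mem_filter.1 hj).2, hmin j hj⟩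
    have h3 : ε + ε = (2 ^ h)⁻¹ := by
      rw [hε, pow_succ]
      field_simp
      norm_num
    linarith

end Recoding

/-! ### Computability of the codes and the recoding machine -/

section Machine

variable {e : ℕ → Option (List Bool × List Bool)}

theorem outputNumber_primrec (he : Primrec e) : Primrec (outputNumber e) := by
  refine (Primrec.option_casesOn (g := fun (_ : ℕ) (a : List Bool × List Bool) =>
    Encodable.encode a.2) he (Primrec.const 0)
    (Primrec.encode.comp (Primrec.snd.comp Primrec.snd)).to₂).of_eq fun j => ?_
  unfold outputNumber
  cases e j <;> rfl

theorem scaledWeight_primrec (he : Primrec e) : Primrec₂ (scaledWeight e) := by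
  refine (Primrec.option_casesOn (g := fun (b : ℕ × ℕ) (a : List Bool × List Bool) =>
    2 ^ (b.1 - a.1.length)) (he.comp Primrec.snd) (Primrec.const 0)
    (Primrec.two_pow.comp (Primrec.nat_sub.comp (Primrec.fst.comp Primrec.fst)
      (Primrec.list_length.comp (Primrec.fst.comp Primrec.snd)))).to₂).of_eq fun b => ?_
  unfold scaledWeight
  cases e b.2 <;> rfl

/-- A program is not longer than its index, so the subtraction in `scaledWeight` is not truncated.
This turns the real inequalities in `InTail` and `IsTailCode` into primitive recursive ones between
naturals. -/
theorem cast_scaledWeight (hlen : ∀ i p x, e i = some (p, x) → p.length ≤ i) {M j : ℕ}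
    (hj : j ≤ M) : (scaledWeight e M j : ℝ) = programWeight e j * 2 ^ M := by
  unfold scaledWeight programWeight
  rcases hej : e j with _ | ⟨p, x⟩
  · simp
  · obtain ⟨m, rfl⟩ := Nat.exists_eq_add_of_le ((hlen j p x hej).trans hj)
    simp [pow_add]

theorem inTail_iff (hlen : ∀ i p x, e i = some (p, x) → p.length ≤ i) (N h n : ℕ) :
    InTail e N h n ↔ (∑ j ∈ Finset.range N,
      if n ≤ outputNumber e j then scaledWeight e N j else 0) * 2 ^ (h + 1) ≤ 2 ^ N := by
  have hs : ((∑ j ∈ Finset.range N, if n ≤ outputNumber e j then scaledWeight e N j else 0 : ℕ) :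
      ℝ) = (∑ j ∈ Finset.range N, if n ≤ outputNumber e j then programWeight e j else 0) *
        2 ^ N := by
    push_cast
    rw [Finset.sum_mul]
    refine Finset.sum_congr rfl fun j hj => ?_
    rw [ite_mul, zero_mul, cast_scaledWeight hlen (Finset.mem_range.1 hj).le]
  rw [← Nat.cast_le (α := ℝ), Nat.cast_mul, hs]
  unfold InTail
  push_cast
  rw [← one_div, le_div_iff₀ (by positivity), mul_right_comm]
  exact (mul_le_iff_le_one_left (by positivity)).symm

theorem inTail_primrec (he : Primrec e)
    (hlen : ∀ i p x, e i = some (p, x) → p.length ≤ i) :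
    PrimrecPred fun a : (ℕ × ℕ) × ℕ => InTail e a.1.1 a.1.2 a.2 := by
  have h : PrimrecPred fun a : (ℕ × ℕ) × ℕ => (∑ j ∈ Finset.range a.1.1,
      if a.2 ≤ outputNumber e j then scaledWeight e a.1.1 j else 0) * 2 ^ (a.1.2 + 1) ≤
        2 ^ a.1.1 := by
    have hN : Primrec fun a : (ℕ × ℕ) × ℕ => a.1.1 := Primrec.fst.comp Primrec.fst
    refine Primrec.nat_le.comp (Primrec.nat_mul.comp (Primrec.sum_range ?_ hN)
      (Primrec.two_pow.comp (Primrec.succ.comp (Primrec.snd.comp Primrec.fst))))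
      (Primrec.two_pow.comp hN)
    exact Primrec.ite (Primrec.nat_le.comp (Primrec.snd.comp Primrec.fst)
      ((outputNumber_primrec he).comp Primrec.snd))
      ((scaledWeight_primrec he).comp (hN.comp Primrec.fst) Primrec.snd) (Primrec.const 0)
  exact h.of_eq fun a => (inTail_iff hlen _ _ _).symm

open Classical in
/-- `tailMeasure` in units of `2^{-i}`. -/
noncomputable def scaledTailMeasure (e : ℕ → Option (List Bool × List Bool)) (N h i : ℕ) : ℕ :=
  ∑ j ∈ Finset.range i, if InTail e N h (outputNumber e j) then scaledWeight e i j else 0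

theorem scaledTailMeasure_primrec (he : Primrec e)
    (hlen : ∀ i p x, e i = some (p, x) → p.length ≤ i) :
    Primrec fun a : (ℕ × ℕ) × ℕ => scaledTailMeasure e a.1.1 a.1.2 a.2 := by
  classical
  refine Primrec.sum_range ?_ Primrec.snd
  exact Primrec.ite ((inTail_primrec he hlen).comp ((Primrec.fst.comp Primrec.fst).pair
      ((outputNumber_primrec he).comp Primrec.snd)))
    ((scaledWeight_primrec he).comp (Primrec.snd.comp Primrec.fst) Primrec.snd)
    (Primrec.const 0)

theorem cast_scaledTailMeasure (hlen : ∀ i p x, e i = some (p, x) → p.length ≤ i) (N h i : ℕ) :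
    (scaledTailMeasure e N h i : ℝ) = tailMeasure e N h i * 2 ^ i := by
  classical
  unfold scaledTailMeasure tailMeasure
  push_cast
  rw [Finset.sum_mul]
  refine Finset.sum_congr rfl fun j hj => ?_
  rw [ite_mul, zero_mul, cast_scaledWeight hlen (Finset.mem_range.1 hj).le]

theorem isTailCode_iff (hlen : ∀ i p x, e i = some (p, x) → p.length ≤ i) (N h i : ℕ)
    (q : List Bool) :
    IsTailCode e N h i q ↔ InTail e N h (outputNumber e i) ∧
      (e i).map (fun a => a.1.length + 1) = some (q.length + h) ∧
      2 ^ h * scaledTailMeasure e N h i * 2 ^ q.length ≤ binVal q * 2 ^ i ∧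
      (binVal q + 1) * 2 ^ i ≤
        2 ^ h * (scaledTailMeasure e N h i + scaledWeight e i i) * 2 ^ q.length := by
  have hi : (0 : ℝ) < 2 ^ i := by positivity
  refine and_congr Iff.rfl (and_congr ?_ (and_congr ?_ ?_))
  · rw [Option.map_eq_some_iff]
    exact exists_congr fun a => and_congr_right fun _ => eq_comm
  · rw [← Nat.cast_le (α := ℝ)]
    push_cast
    rw [cast_scaledTailMeasure hlen, le_div_iff₀ (by positivity), ← mul_le_mul_iff_left₀ hi]
    apply iff_of_eq
    congr 1
    ring
  · rw [← Nat.cast_le (α := ℝ)]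
    push_cast
    rw [cast_scaledTailMeasure hlen, cast_scaledWeight hlen le_rfl, div_le_iff₀ (by positivity),
      ← mul_le_mul_iff_left₀ hi]
    apply iff_of_eq
    congr 1
    ring

theorem isTailCode_primrec (he : Primrec e)
    (hlen : ∀ i p x, e i = some (p, x) → p.length ≤ i) :
    PrimrecPred fun a : (ℕ × ℕ) × ℕ × List Bool => IsTailCode e a.1.1 a.1.2 a.2.1 a.2.2 := by
  have hi : Primrec fun a : (ℕ × ℕ) × ℕ × List Bool => a.2.1 := Primrec.fst.comp Primrec.snd
  have hh : Primrec fun a : (ℕ × ℕ) × ℕ × List Bool => a.1.2 := Primrec.snd.comp Primrec.fst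
  have hq : Primrec fun a : (ℕ × ℕ) × ℕ × List Bool => a.2.2 := Primrec.snd.comp Primrec.snd
  have hl := Primrec.list_length.comp hq
  have ht : Primrec fun a : (ℕ × ℕ) × ℕ × List Bool => scaledTailMeasure e a.1.1 a.1.2 a.2.1 :=
    Primrec.comp (f := fun a : (ℕ × ℕ) × ℕ => scaledTailMeasure e a.1.1 a.1.2 a.2)
      (g := fun a : (ℕ × ℕ) × ℕ × List Bool => (a.1, a.2.1))
      (scaledTailMeasure_primrec he hlen) (Primrec.fst.pair hi)
  have hw : Primrec fun a : (ℕ × ℕ) × ℕ × List Bool => scaledWeight e a.2.1 a.2.1 :=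
    (scaledWeight_primrec he).comp hi hi
  have hb := primrec_binVal.comp hq
  have h1 : PrimrecPred fun a : (ℕ × ℕ) × ℕ × List Bool =>
      InTail e a.1.1 a.1.2 (outputNumber e a.2.1) :=
    (inTail_primrec he hlen).comp (Primrec.fst.pair ((outputNumber_primrec he).comp hi))
  have h2 : PrimrecPred fun a : (ℕ × ℕ) × ℕ × List Bool =>
      (e a.2.1).map (fun a => a.1.length + 1) = some (a.2.2.length + a.1.2) :=
    Primrec.eq.comp (Primrec.option_map (he.comp hi)
      (Primrec.succ.comp (Primrec.list_length.comp (Primrec.fst.comp Primrec.snd))).to₂)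
      (Primrec.option_some.comp (Primrec.nat_add.comp hl hh))
  have h3 : PrimrecPred fun a : (ℕ × ℕ) × ℕ × List Bool =>
      2 ^ a.1.2 * scaledTailMeasure e a.1.1 a.1.2 a.2.1 * 2 ^ a.2.2.length ≤
        binVal a.2.2 * 2 ^ a.2.1 :=
    Primrec.nat_le.comp
      (Primrec.nat_mul.comp (Primrec.nat_mul.comp (Primrec.two_pow.comp hh) ht)
        (Primrec.two_pow.comp hl))
      (Primrec.nat_mul.comp hb (Primrec.two_pow.comp hi))
  have h4 : PrimrecPred fun a : (ℕ × ℕ) × ℕ × List Bool =>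
      (binVal a.2.2 + 1) * 2 ^ a.2.1 ≤ 2 ^ a.1.2 *
        (scaledTailMeasure e a.1.1 a.1.2 a.2.1 + scaledWeight e a.2.1 a.2.1) *
          2 ^ a.2.2.length :=
    Primrec.nat_le.comp
      (Primrec.nat_mul.comp (Primrec.succ.comp hb) (Primrec.two_pow.comp hi))
      (Primrec.nat_mul.comp (Primrec.nat_mul.comp (Primrec.two_pow.comp hh)
        (Primrec.nat_add.comp ht hw)) (Primrec.two_pow.comp hl))
  exact (h1.and (h2.and (h3.and h4))).of_eq fun a => (isTailCode_iff hlen _ _ _ _).symm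

/-- `q` preceded by the unary code of `g`. -/
def unaryPrefix (g : ℕ) (q : List Bool) : List Bool :=
  (List.cons true)^[g] (false :: q)

theorem unaryPrefix_zero (q : List Bool) : unaryPrefix 0 q = false :: q := rfl

theorem unaryPrefix_succ (g : ℕ) (q : List Bool) :
    unaryPrefix (g + 1) q = true :: unaryPrefix g q :=
  Function.iterate_succ_apply' _ _ _

theorem length_unaryPrefix (g : ℕ) (q : List Bool) :
    (unaryPrefix g q).length = g + 1 + q.length := by
  induction g with
  | zero => simp [unaryPrefix_zero]; omega
  | succ g ih => rw [unaryPrefix_succ, List.length_cons, ih]; omega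

theorem unaryPrefix_prefix {g g' : ℕ} {q q' : List Bool}
    (h : unaryPrefix g q <+: unaryPrefix g' q') : g = g' ∧ q <+: q' := by
  induction g generalizing g' with
  | zero =>
    cases g' with
    | zero => exact ⟨rfl, by simpa [unaryPrefix_zero] using h⟩
    | succ g' => simp [unaryPrefix_zero, unaryPrefix_succ] at h
  | succ g ih =>
    cases g' with
    | zero => simp [unaryPrefix_zero, unaryPrefix_succ] at h
    | succ g' =>
      simp only [unaryPrefix_succ, List.cons_prefix_cons, true_and] at h
      exact ⟨congrArg _ (ih h).1, (ih h).2⟩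

theorem unaryPrefix_primrec : Primrec₂ unaryPrefix :=
  Primrec.nat_iterate Primrec.fst (Primrec.list_cons.comp (Primrec.const false) Primrec.snd)
    (Primrec.list_cons.comp (Primrec.const true) Primrec.snd).to₂

open Classical in
/-- The search predicate of the recoding machine. -/
noncomputable def recodeSearch (e : ℕ → Option (List Bool × List Bool))
    (a : List Bool × List Bool) (m : ℕ) : Option (List Bool) :=
  (Encodable.decode m : Option (ℕ × ℕ × List Bool)).bind fun b =>
    if a.1 = unaryPrefix b.1 b.2.2 ∧
        IsTailCode e (Encodable.encode a.2) (2 * b.1) b.2.1 b.2.2 then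
      (e b.2.1).map Prod.snd
    else none

theorem recodeSearch_primrec (he : Primrec e)
    (hlen : ∀ i p x, e i = some (p, x) → p.length ≤ i) : Primrec₂ (recodeSearch e) := by
  classical
  refine Primrec.option_bind (Primrec.decode.comp Primrec.snd) ?_
  have ha : Primrec fun c : ((List Bool × List Bool) × ℕ) × ℕ × ℕ × List Bool => c.1.1 :=
    Primrec.fst.comp Primrec.fst
  have hg : Primrec fun c : ((List Bool × List Bool) × ℕ) × ℕ × ℕ × List Bool => c.2.1 :=
    Primrec.fst.comp Primrec.snd
  have hiq : Primrec fun c : ((List Bool × List Bool) × ℕ) × ℕ × ℕ × List Bool => c.2.2 :=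
    Primrec.snd.comp Primrec.snd
  refine Primrec.ite (PrimrecPred.and ?_ ?_) ?_ (Primrec.const none)
  · exact Primrec.eq.comp (Primrec.fst.comp ha)
      (unaryPrefix_primrec.comp hg (Primrec.snd.comp hiq))
  · exact (isTailCode_primrec he hlen).comp
      (((Primrec.encode.comp (Primrec.snd.comp ha)).pair
        (Primrec.nat_mul.comp (Primrec.const 2) hg)).pair hiq)
  · exact Primrec.option_map (he.comp (Primrec.fst.comp hiq))
      (Primrec.snd.comp Primrec.snd).to₂

theorem mem_recodeSearch {p y x : List Bool} {m : ℕ} (h : x ∈ recodeSearch e (p, y) m) :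
    ∃ g i q, p = unaryPrefix g q ∧ IsTailCode e (Encodable.encode y) (2 * g) i q ∧
      (e i).map Prod.snd = some x := by
  classical
  obtain ⟨⟨g, i, q⟩, -, hb⟩ := Option.bind_eq_some_iff.1 (Option.mem_def.1 h)
  simp only at hb
  split_ifs at hb with hc
  exact ⟨g, i, q, hc.1, hc.2, hb⟩

theorem exists_mem_recodeSearch {y x q : List Bool} {g i : ℕ}
    (hq : IsTailCode e (Encodable.encode y) (2 * g) i q) (hx : (e i).map Prod.snd = some x) :
    ∃ m, x ∈ recodeSearch e (unaryPrefix g q, y) m := by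
  classical
  refine ⟨Encodable.encode (g, i, q), ?_⟩
  simp [recodeSearch, Encodable.encodek, hq, hx]

/-- The machine that, given a string numbered `N`, decodes shortened codes of those programs whose
output is in the tail at stage `N`. -/
noncomputable def recodeMachine (he : Primrec e)
    (hlen : ∀ i p x, e i = some (p, x) → p.length ≤ i) : PrefixMachine where
  eval p y := Nat.rfindOpt (recodeSearch e (p, y))
  partrec := Partrec.rfindOpt (recodeSearch_primrec he hlen).to_comp
  prefix_free y p q hp hq hpq := by
    obtain ⟨_, _, hx⟩ := Nat.rfindOpt_dom.1 hp
    obtain ⟨_, _, hy⟩ := Nat.rfindOpt_dom.1 hq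
    obtain ⟨g, i, p, rfl, hcp, -⟩ := mem_recodeSearch hx
    obtain ⟨g', i', q, rfl, hcq, -⟩ := mem_recodeSearch hy
    obtain ⟨rfl, h⟩ := unaryPrefix_prefix hpq
    rw [(hcp.eq_of_prefix hcq h).2]

/-- The search may stop at another witness, but the program determines `g` and `q`, and `q`
determines the index `i`, so the output is the same. -/
theorem mem_recodeMachine (he : Primrec e)
    (hlen : ∀ i p x, e i = some (p, x) → p.length ≤ i) {y x q : List Bool} {g i : ℕ}
    (hq : IsTailCode e (Encodable.encode y) (2 * g) i q) (hx : (e i).map Prod.snd = some x) :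
    x ∈ (recodeMachine he hlen).eval (unaryPrefix g q) y := by
  obtain ⟨m, hm⟩ := exists_mem_recodeSearch hq hx
  have hd : (Nat.rfindOpt (recodeSearch e (unaryPrefix g q, y))).Dom :=
    Nat.rfindOpt_dom.2 ⟨m, x, hm⟩
  have hz := Part.get_mem hd
  obtain ⟨_, hz'⟩ := Nat.rfindOpt_spec hz
  obtain ⟨g', i', q', hpre, hq', hx'⟩ := mem_recodeSearch hz'
  obtain ⟨rfl, h⟩ := unaryPrefix_prefix (hpre ▸ List.prefix_rfl :
    unaryPrefix g q <+: unaryPrefix g' q')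
  obtain ⟨rfl, -⟩ := hq.eq_of_prefix hq' h
  rw [hx] at hx'
  rw [Option.some.inj hx']
  exact hz

end Machine

/-! ### Consequences of universality and the bound for independent strings -/

namespace PrefixMachine

variable {U : PrefixMachine}

theorem condK_le_length {p x y : List Bool} (h : x ∈ U.eval p y) : U.condK x y ≤ p.length :=
  Nat.sInf_le ⟨p, rfl, h⟩

/-- The machine whose only program, the empty one, outputs `x`. -/
def constMachine (x : List Bool) : PrefixMachine where
  eval p _ := bif p.isEmpty then Part.some x else Part.none
  partrec := by
    refine (Partrec.cond (c := fun a : List Bool × List Bool => a.1.isEmpty) ?_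
      (Computable.const x).partrec Partrec.none).of_eq fun _ => rfl
    have : Primrec fun a : List Bool × List Bool => decide (a.1.length = 0) :=
      (Primrec.eq.comp (Primrec.list_length.comp Primrec.fst) (Primrec.const 0)).decide
    exact (this.of_eq fun a => by cases a.1 <;> simp).to_comp
  prefix_free y p q hp hq _ := by
    cases p with
    | nil =>
      cases q with
      | nil => rfl
      | cons => simp at hq
    | cons => simp at hp

theorem IsUniversal.exists_program (hU : U.IsUniversal) (x y : List Bool) :
    ∃ p, p.length = U.condK x y ∧ x ∈ U.eval p y := by
  obtain ⟨d, hd⟩ := hU (constMachine x)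
  obtain ⟨q, -, hq⟩ := hd [] y x (by simp [constMachine])
  exact Nat.sInf_mem (s := {n | ∃ p : List Bool, p.length = n ∧ x ∈ U.eval p y}) ⟨_, q, rfl, hq⟩

theorem IsUniversal.exists_condK_le_of_machine (hU : U.IsUniversal) (V : PrefixMachine) :
    ∃ d, ∀ p y x, x ∈ V.eval p y → U.condK x y ≤ p.length + d := by
  obtain ⟨d, hd⟩ := hU V
  refine ⟨d, fun p y x h => ?_⟩
  obtain ⟨q, hl, hq⟩ := hd p y x h
  exact (condK_le_length hq).trans hl

/-- For every `b` there is a bound such that two strings whose numbers both exceed it share more than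
`b` bits of information. In particular, if `y` ranges over strings with `I(y : x) ≤ b` and `x` is
beyond the bound, then only finitely many `y` are possible. -/
theorem IsUniversal.exists_bound_of_independent (hU : U.IsUniversal) (b : ℕ) :
    ∃ M, ∀ x y : List Bool, U.K x ≤ U.condK x y + b →
      Encodable.encode x < M ∨ Encodable.encode y < M := by
  obtain ⟨e, he⟩ := U.exists_isProgramEnum
  obtain ⟨d, hd⟩ := hU.exists_condK_le_of_machine (recodeMachine he.primrec he.length_le)
  -- With g = b + d + 3 the new program has length |p| + 2 - g = |p| - b - d - 1, which beats `b`
  -- even after paying the simulation cost `d`. There is no circularity: the machine reads `g` from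
  -- its program, so `d` does not depend on `g`.
  obtain ⟨M, hM⟩ := exists_tail_bounds he (2 * (b + d + 3))
  refine ⟨M, fun x y hxy => ?_⟩
  by_contra! hlt
  obtain ⟨htail, hmeas⟩ := hM _ hlt.2
  obtain ⟨p, hp, hx⟩ := hU.exists_program x []
  obtain ⟨i, hi⟩ := he.complete p x hx
  have hin : InTail e (Encodable.encode y) (2 * (b + d + 3)) (outputNumber e i) := by
    rw [outputNumber_of_eq hi]
    exact htail _ hlt.1
  obtain ⟨q, hq⟩ := exists_isTailCode hi hin (hmeas _)
  have hle := hd _ _ _ (mem_recodeMachine he.primrec he.length_le hq (by rw [hi]; rfl))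
  obtain ⟨-, ⟨a, ha, hl⟩, -⟩ := hq
  obtain rfl : (p, x) = a := Option.some.inj (hi.symm.trans ha)
  rw [length_unaryPrefix] at hle
  change p.length = U.K x at hp
  dsimp only at hl hle
  omega

end PrefixMachine

/-! ## Simulation of an adaptation process by a prefix machine -/

theorem AdaptationProcess.computable_instr (P : AdaptationProcess) : Computable P.instr := by
  rw [← Computable.encode_iff]
  refine Partrec.of_eq (Nat.Partrec.Code.eval_part.comp (Computable.const P.code)
    Computable.encode) fun q => ?_
  exact P.computes q

/-- One step of the device on a configuration together with a supply of bits; an erasure writes the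
next bit of the supply. The result is the final execution substrate with the remaining supply, or
the next configuration with its supply. -/
def supplyStep (instr : AdaptConfig → AdaptInstr) (a : AdaptConfig × List Bool) :
    Option ((List Bool × List Bool) ⊕ (AdaptConfig × List Bool)) :=
  Option.casesOn (instr a.1) (some (Sum.inl (a.1.2.1, a.2))) fun c =>
    Sum.casesOn c (fun r => some (Sum.inr (r, a.2))) fun w =>
      a.2.head?.map fun v =>
        Sum.inr ((w.2, a.1.2.1, a.1.2.2.1, a.1.2.2.2.set w.1 v), a.2.tail)

theorem Primrec.listSet {α β : Type*} [Primcodable α] [Primcodable β] {l : α → List β}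
    {i : α → ℕ} {v : α → β} (hl : Primrec l) (hi : Primrec i) (hv : Primrec v) :
    Primrec fun a => (l a).set (i a) (v a) :=
  Primrec.list_set.comp hl (hi.pair hv)

theorem supplyStep_computable {instr : AdaptConfig → AdaptInstr} (hi : Computable instr) :
    Computable (supplyStep instr) := by
  have hS : Primrec fun a : AdaptConfig × List Bool => a.1.2.1 :=
    Primrec.fst.comp (Primrec.snd.comp Primrec.fst)
  have hD : Primrec fun a : AdaptConfig × List Bool => a.1.2.2.1 :=
    Primrec.fst.comp (Primrec.snd.comp (Primrec.snd.comp Primrec.fst))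
  have hW : Primrec fun a : AdaptConfig × List Bool => a.1.2.2.2 :=
    Primrec.snd.comp (Primrec.snd.comp (Primrec.snd.comp Primrec.fst))
  refine Computable.option_casesOn (hi.comp Computable.fst)
    (Primrec.option_some.comp (Primrec.sumInl.comp (hS.pair Primrec.snd))).to_comp ?_
  refine Computable.sumCasesOn Computable.snd ?_ ?_
  · exact (Primrec.option_some.comp (Primrec.sumInr.comp (Primrec.snd.pair
      (Primrec.snd.comp (Primrec.fst.comp Primrec.fst))))).to_comp
  · let α := ((AdaptConfig × List Bool) × (AdaptConfig ⊕ (ℕ × ℕ))) × ℕ × ℕ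
    have ha : Primrec fun b : α × Bool => b.1.1.1 :=
      Primrec.fst.comp (Primrec.fst.comp Primrec.fst)
    have hw : Primrec fun b : α × Bool => b.1.2 := Primrec.snd.comp Primrec.fst
    have hW' : Primrec fun b : α × Bool => b.1.1.1.1.2.2.2 :=
      Primrec.snd.comp (Primrec.snd.comp (Primrec.snd.comp (Primrec.fst.comp ha)))
    have hset : Primrec fun b : α × Bool => b.1.1.1.1.2.2.2.set b.1.2.1 b.2 :=
      hW'.listSet (Primrec.fst.comp hw) Primrec.snd
    have hp : Primrec fun a : α => a.1.1.2 :=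
      Primrec.snd.comp (Primrec.fst.comp Primrec.fst)
    have hnext : Primrec fun b : α × Bool => (Sum.inr ((b.1.2.2, b.1.1.1.1.2.1,
        b.1.1.1.1.2.2.1, b.1.1.1.1.2.2.2.set b.1.2.1 b.2), b.1.1.1.2.tail) :
          (List Bool × List Bool) ⊕ (AdaptConfig × List Bool)) :=
      Primrec.sumInr.comp (((Primrec.snd.comp hw).pair ((hS.comp ha).pair
        ((hD.comp ha).pair hset))).pair (Primrec.list_tail.comp (Primrec.snd.comp ha)))
    exact (Primrec.option_map (Primrec.list_head?.comp hp) hnext.to₂).to_comp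

/-- The whole run of the device on a supply of bits. -/
def supplyRun (instr : AdaptConfig → AdaptInstr) :
    AdaptConfig × List Bool →. List Bool × List Bool :=
  PFun.fix fun a => (supplyStep instr a : Part _)

theorem supplyRun_partrec {instr : AdaptConfig → AdaptInstr} (hi : Computable instr) :
    Partrec (supplyRun instr) :=
  Partrec.fix (supplyStep_computable hi).ofOption

section SupplyRun

variable {instr : AdaptConfig → AdaptInstr}

theorem supplyRun_halt {k : ℕ} {S D W p : List Bool} (h : instr (k, S, D, W) = none) :
    (S, p) ∈ supplyRun instr ((k, S, D, W), p) :=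
  PFun.fix_stop (by simp [supplyStep, h])

theorem supplyStep_append {a : AdaptConfig × List Bool}
    {c : (List Bool × List Bool) ⊕ (AdaptConfig × List Bool)}
    (h : c ∈ supplyStep instr a) (r : List Bool) :
    Sum.map (fun b => (b.1, b.2 ++ r)) (fun b => (b.1, b.2 ++ r)) c ∈
      supplyStep instr (a.1, a.2 ++ r) := by
  obtain ⟨q, p⟩ := a
  unfold supplyStep at h ⊢
  rcases hq : instr q with _ | (q' | ⟨i, l⟩)
  · simp only [hq, Option.mem_def, Option.some.injEq] at h ⊢
    rw [← h]
    rfl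
  · simp only [hq, Option.mem_def, Option.some.injEq] at h ⊢
    rw [← h]
    rfl
  · cases p with
    | nil => simp [hq] at h
    | cons v p =>
      simp only [hq, Option.mem_def, List.head?_cons, List.tail_cons, Option.map_some,
        Option.some.injEq, List.cons_append] at h ⊢
      rw [← h]
      rfl

/-- Bits that a halting run has not read cannot influence it. This is what reduces prefix-freeness
of `adaptMachine` to that of `U`. -/
theorem supplyRun_append {a : AdaptConfig × List Bool} {S p' : List Bool}
    (h : (S, p') ∈ supplyRun instr a) (r : List Bool) :
    (S, p' ++ r) ∈ supplyRun instr (a.1, a.2 ++ r) := by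
  unfold supplyRun at h ⊢
  refine PFun.fixInduction' (C := fun a => (S, p' ++ r) ∈ PFun.fix
    (fun a => (supplyStep instr a : Part _)) (a.1, a.2 ++ r)) h ?_ ?_
  · intro a ha
    exact PFun.fix_stop (Part.mem_ofOption.2 (supplyStep_append (Part.mem_ofOption.1 ha) r))
  · intro a a' _ ha ih
    have := supplyStep_append (Part.mem_ofOption.1 ha) r
    exact PFun.mem_fix_iff.2 (Or.inr ⟨_, Part.mem_ofOption.2 this, ih⟩)

/-- The supply `v` is the sequence of bits written by the erasures, in order; all other steps are
deterministic. -/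
theorem AdaptRun.exists_supply {q r : AdaptConfig} {n : ℕ} (h : AdaptRun instr q n r) :
    ∃ v : List Bool, v.length = n ∧
      ∀ p, supplyRun instr (q, v ++ p) = supplyRun instr (r, p) := by
  induction h with
  | refl => exact ⟨[], rfl, fun p => rfl⟩
  | step r s m n _ hs ih =>
    obtain ⟨v, hv, ih⟩ := ih
    cases hs with
    | reversible _ _ hr =>
      refine ⟨v, hv, fun p => (ih p).trans ?_⟩
      exact PFun.fix_fwd_eq (by simp [supplyStep, hr])
    | erase k l i S D W c hr hi =>
      refine ⟨v ++ [c], by simp [hv], fun p => ?_⟩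
      rw [List.append_assoc, ih]
      exact PFun.fix_fwd_eq (by simp [supplyStep, hr])

end SupplyRun

namespace PrefixMachine

/-- Run the device from the initial substrate `S₀` on the side input, with erasures supplied by the
program, and then run `U` on the rest of the program given the final substrate. -/
def adaptMachine (U : PrefixMachine) {instr : AdaptConfig → AdaptInstr} (hi : Computable instr)
    (S₀ : List Bool) : PrefixMachine where
  eval p D := (supplyRun instr ((0, S₀, D, []), p)).bind fun b => U.eval b.2 b.1
  partrec := by
    refine Partrec.bind ((supplyRun_partrec hi).comp ?_) ?_
    · exact (((Primrec.const 0).pair ((Primrec.const S₀).pair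
        (Primrec.snd.pair (Primrec.const [])))).pair Primrec.fst).to_comp
    · exact Partrec₂.comp U.partrec (Computable.snd.comp Computable.snd)
        (Computable.fst.comp Computable.snd)
  prefix_free D p q hp hq hpq := by
    obtain ⟨r, rfl⟩ := hpq
    obtain ⟨x, hx⟩ := Part.dom_iff_mem.1 hp
    obtain ⟨y, hy⟩ := Part.dom_iff_mem.1 hq
    obtain ⟨⟨S, p'⟩, hS, hx⟩ := Part.mem_bind_iff.1 hx
    obtain ⟨b, hb, hy⟩ := Part.mem_bind_iff.1 hy
    obtain rfl := Part.mem_unique hb (supplyRun_append hS r)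
    have := U.prefix_free S p' (p' ++ r) (Part.dom_iff_mem.2 ⟨x, hx⟩)
      (Part.dom_iff_mem.2 ⟨y, hy⟩) (List.prefix_append _ _)
    rw [List.self_eq_append_right.1 this, List.append_nil]

variable {U : PrefixMachine}

theorem IsUniversal.exists_condK_le_of_adapts (hU : U.IsUniversal) (P : AdaptationProcess)
    (S₀ : List Bool) :
    ∃ d, ∀ (D S x : List Bool) (H : ℕ), P.Adapts S₀ D S H →
      U.condK x D ≤ U.condK x S + H + d := by
  obtain ⟨d, hd⟩ := hU.exists_condK_le_of_machine (U.adaptMachine P.computable_instr S₀)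
  refine ⟨d, fun D S x H h => ?_⟩
  obtain ⟨k, D', W, hrun, hhalt⟩ := h
  obtain ⟨v, hv, hsup⟩ := hrun.exists_supply
  obtain ⟨p, hp, hx⟩ := hU.exists_program x S
  have := hd (v ++ p) D x (Part.mem_bind_iff.2
    ⟨(S, p), by rw [hsup]; exact supplyRun_halt hhalt, hx⟩)
  rw [List.length_append] at this
  omega

/-- Different strings have different shortest programs, and there are finitely many programs of
length at most `b`. -/
theorem IsUniversal.finite_setOf_K_le (hU : U.IsUniversal) (b : ℕ) :
    {x : List Bool | U.K x ≤ b}.Finite := by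
  choose p hp hx using fun x => hU.exists_program x []
  refine Set.Finite.of_finite_image (f := p) ((List.finite_length_le Bool b).subset ?_) ?_
  · rintro _ ⟨x, hxb, rfl⟩
    exact (hp x).trans_le hxb
  · intro x _ y _ hxy
    exact Part.mem_unique (hx x) (hxy ▸ hx y)

theorem IsUniversal.exists_condK_le (hU : U.IsUniversal) (x : List Bool) :
    ∃ d, ∀ y, U.condK x y ≤ d := by
  obtain ⟨d, hd⟩ := hU.exists_condK_le_of_machine (constMachine x)
  exact ⟨[].length + d, fun y => hd [] y x (by simp [constMachine])⟩

end PrefixMachine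

/-! ### Uniform constants and the energy bound -/

theorem AdaptationProcess.instr_eq_of_description_eq {P Q : AdaptationProcess}
    (h : P.description = Q.description) : P.instr = Q.instr := by
  have hc : P.code = Q.code := by
    apply Encodable.encode_injective
    refine Nat.digits.injective 2 ?_
    rw [Nat.digits_two_eq_bits, Nat.digits_two_eq_bits]
    exact congrArg _ h
  funext q
  apply Encodable.encode_injective
  have := P.computes q
  rw [hc, Q.computes q] at this
  exact (Part.some_injective this).symm

theorem Set.Finite.exists_nat_forall_mem {α : Type*} {s : Set α} (hs : s.Finite)
    {p : α → ℕ → Prop} (hmono : ∀ a m n, m ≤ n → p a m → p a n) (h : ∀ a ∈ s, ∃ n, p a n) :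
    ∃ n, ∀ a ∈ s, p a n := by
  choose! f hf using h
  obtain ⟨n, hn⟩ := (hs.image f).bddAbove
  exact ⟨n, fun a ha => hmono a _ _ (hn ⟨a, ha, rfl⟩) (hf a ha)⟩

theorem finite_setOf_encode_lt (M : ℕ) : {x : List Bool | Encodable.encode x < M}.Finite :=
  (Set.finite_lt_nat M).preimage Encodable.encode_injective.injOn

/-- Adaptation processes of bounded description started in finitely many states are simulated with
a common constant. -/
theorem PrefixMachine.IsUniversal.exists_uniform_condK_le_of_adapts {U : PrefixMachine}
    (hU : U.IsUniversal) (b M : ℕ) :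
    ∃ d, ∀ P : AdaptationProcess, U.K P.description ≤ b →
      ∀ S₀ : List Bool, Encodable.encode S₀ < M →
      ∀ (D S x : List Bool) (H : ℕ), P.Adapts S₀ D S H →
        U.condK x D ≤ U.condK x S + H + d := by
  obtain ⟨d, hd⟩ := ((hU.finite_setOf_K_le b).prod
    (finite_setOf_encode_lt M)).exists_nat_forall_mem
    (p := fun a d => ∀ P : AdaptationProcess, P.description = a.1 →
      ∀ (D S x : List Bool) (H : ℕ), P.Adapts a.2 D S H → U.condK x D ≤ U.condK x S + H + d)
    (fun a m n hmn h P hP D S x H hA => (h P hP D S x H hA).trans (by omega))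
    (fun a _ => by
      -- One representative per description suffices, since `Adapts` depends only on `instr`; a
      -- string describing no process imposes no condition.
      by_cases hex : ∃ Q : AdaptationProcess, Q.description = a.1
      · obtain ⟨Q, hQ⟩ := hex
        obtain ⟨d, hd⟩ := hU.exists_condK_le_of_adapts Q a.2
        refine ⟨d, fun P hP D S x H hA => hd D S x H ?_⟩
        unfold AdaptationProcess.Adapts at hA ⊢
        rwa [← AdaptationProcess.instr_eq_of_description_eq (hP.trans hQ.symm)]
      · exact ⟨0, fun P hP => (hex ⟨P, hP⟩).elim⟩)
  exact ⟨d, fun P hP S₀ hS₀ => hd (P.description, S₀) ⟨hP, hS₀⟩ P rfl⟩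

theorem landauerCost_nonneg {T : ℝ} (hT : 0 < T) : 0 ≤ landauerCost T := by
  unfold landauerCost boltzmannConstant
  have := Real.log_nonneg (show (1 : ℝ) ≤ 2 by norm_num)
  positivity

theorem theorem2 (U : PrefixMachine) (hU : U.IsUniversal) (b : ℕ) :
    ∃ cU : ℕ,
      -- adaptation processes of constant-size description
      ∀ P : AdaptationProcess, U.K P.description ≤ b →
      -- the class descriptor, and an initial substrate state carrying no information about it
      ∀ σ S₀ : List Bool, U.K σ ≤ U.condK σ S₀ + b →
      -- adaptation input, post-adaptation substrate state, number of logical erasures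
      ∀ (D S : List Bool) (Herase : ℕ), P.Adapts S₀ D S Herase →
      -- adaptation substrate, ambient temperature, adaptation energy
      ∀ (Hadapt : Substrate) (T Eadapt : ℝ), 0 < T → Hadapt.EnergyFloor T Herase Eadapt →
        Eadapt ≥ Hadapt.overhead * landauerCost T *
          max (U.mutualInfo S σ - U.mutualInfo D σ - (cU : ℝ)) 0 := by
  obtain ⟨M, hM⟩ := hU.exists_bound_of_independent b
  obtain ⟨d₁, hd₁⟩ := hU.exists_uniform_condK_le_of_adapts b M
  obtain ⟨d₂, hd₂⟩ := (finite_setOf_encode_lt M).exists_nat_forall_mem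
    (p := fun x d => ∀ y, U.condK x y ≤ d) (fun x m n hmn h y => (h y).trans hmn)
    fun x _ => hU.exists_condK_le x
  refine ⟨d₁ + d₂, fun P hP σ S₀ hσ D S H hA X T E hT hE => ?_⟩
  have key : U.condK σ D ≤ U.condK σ S + H + (d₁ + d₂) := by
    -- Either σ is one of finitely many strings and costs at most `d₂` bits given anything, or S₀ is
    -- one of finitely many and the simulation applies with constant `d₁`.
    rcases hM σ S₀ hσ with h | h
    · have := hd₂ σ h D
      omega
    · have := hd₁ P hP S₀ h D S σ H hA
      omega
  have key' : (U.condK σ D : ℝ) ≤ U.condK σ S + H + ((d₁ + d₂ : ℕ) : ℝ) := by exact_mod_cast key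
  have hmax : max (U.mutualInfo S σ - U.mutualInfo D σ - ((d₁ + d₂ : ℕ) : ℝ)) 0 ≤ H := by
    refine max_le ?_ (Nat.cast_nonneg H)
    unfold PrefixMachine.mutualInfo
    linarith
  have hX : 0 ≤ X.overhead := zero_le_one.trans X.one_le_overhead
  calc X.overhead * landauerCost T *
        max (U.mutualInfo S σ - U.mutualInfo D σ - ((d₁ + d₂ : ℕ) : ℝ)) 0
      ≤ X.overhead * landauerCost T * H :=
        mul_le_mul_of_nonneg_left hmax (mul_nonneg hX (landauerCost_nonneg hT))
    _ = X.overhead * H * landauerCost T := by ring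
    _ ≤ E := hE
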